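/- Let $\lambda_1,\lambda_2,\lambda_3\ge 0$ with $\lambda_1^2+\lambda_2^2+\lambda_3^2=1$, let $|\psi_{gW}\rangle=\lambda_1|100\rangle+\lambda_2|010\rangle+\lambda_3|001\rangle$ be the corresponding generalized $W$ state of three qubits, and let $\psi_{gW}=|\psi_{gW}\rangle\langle\psi_{gW}|$. Write $h(x)=-x\log_2x-(1-x)\log_2(1-x)$ and $S(\rho)=-\mathrm{Tr}(\rho\log_2\rho)$, with $0\log_20=0$. The dense coding capacity of a two-qubit state $\rho_{kl}$, with sender $k$ and receiver $l$, is $C(\rho_{kl})=1+S(\rho_l)-S(\rho_{kl})$. For $\{j,k,l\}=\{1,2,3\}$ and a three-qubit state $\rho$, let qubit $j$ belong to a controller, who measures it in the basis $\{U^\dagger|0\rangle,U^\dagger|1\rangle\}$ given by a $2\times2$ unitary $U$, and let $\rho_{kl}^i$ be the state of the qubits $k,l$ after the outcome $i$, which has probability $\langle i|U\rho_jU^\dagger|i\rangle$. Put $$C_{CD}^{jkl}(\rho)=\max_U\sum_{i=0}^1\langle i|U\rho_jU^\dagger|i\rangle\,C(\rho_{kl}^i),\qquad P^{jkl}(\rho)=C_{CD}^{jkl}(\rho)-C(\rho_{kl}),\qquad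 P(\rho)=\min_{j,k,l}P^{jkl}(\rho),$$ the last minimum being over all permutations $(j,k,l)$ of $(1,2,3)$; $P^{jkl}$ is the control power and $P$ the minimal control power. Then: 1. For all $j,k,l$ the maximum that defines $C_{CD}^{jkl}(\psi_{gW})$ is attained at $U=1$, that is, the computational basis $\{|0\rangle,|1\rangle\}$ is an optimal measurement basis of the controller. 2. For all $j,k,l$, $$P^{jkl}(\psi_{gW})=(\lambda_j^2+\lambda_k^2)\,h\!\left(\frac{\lambda_j^2}{\lambda_j^2+\lambda_k^2}\right),$$ where the right-hand side is read as $0$ if $\lambda_j=\lambda_k=0$. 3. If $\lambda_l=\max\{\lambda_1,\lambda_2,\lambda_3\}$, then $$P(\psi_{gW})=P^{jkl}(\psi_{gW})=(\lambda_j^2+\lambda_k^2)\,h\!\left(\frac{\lambda_j^2}{\lambda_j^2+\lambda_k^2}\right).$$ 4. $P(\psi_{gW})=0$ if and only if some $\lambda_i=0$, and this holds if and only if $|\psi_{gW}\rangle$ is biseparable or fully separable, that is, the product of a vector of one qubit and a vector of the other two. -/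

import Mathlib

namespace DenseCoding

open scoped Matrix

noncomputable section

/-- Computational-basis labels of three qubits; the qubits are numbered by `Fin 3`. -/
abbrev Bits3 : Type := Fin 3 → Fin 2

/-- An operator on one qubit. -/
abbrev Op1 : Type := Matrix (Fin 2) (Fin 2) ℂ

/-- An operator on two qubits. -/
abbrev Op2 : Type := Matrix (Fin 2 × Fin 2) (Fin 2 × Fin 2) ℂ

/-- An operator on three qubits. -/
abbrev Op3 : Type := Matrix Bits3 Bits3 ℂ

/-- The binary entropy function `h(x) = -x log₂ x - (1 - x) log₂ (1 - x)`, with `0 log₂ 0 = 0`. -/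
def binaryEntropy (x : ℝ) : ℝ :=
  -x * Real.logb 2 x - (1 - x) * Real.logb 2 (1 - x)

/-- The von Neumann entropy `S(ρ) = -Tr(ρ log₂ ρ)` of a density matrix, where `log₂ ρ` is taken in
the functional calculus of Hermitian matrices. Since `Real.logb 2 0 = 0`, the kernel of `ρ`
contributes `0`, as usual. -/
def vonNeumannEntropy {n : Type} [Fintype n] [DecidableEq n] (ρ : Matrix n n ℂ) : ℝ :=
  -((ρ * cfc (Real.logb 2) ρ).trace).re

/-- The reduced state `ρ₂ = Tr₁ ρ₁₂` of the second of two qubits. -/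
def traceFirst (ρ : Op2) : Op1 :=
  Matrix.of fun b b' => ∑ a, ρ (a, b) (a, b')

/-- The dense coding channel capacity `C(ρ₁₂) = 1 + S(ρ₂) - S(ρ₁₂)`; the sender has the first
qubit, the receiver has the second. -/
def capacity (ρ : Op2) : ℝ :=
  1 + vonNeumannEntropy (traceFirst ρ) - vonNeumannEntropy ρ

/-- The basis label whose qubits `j, k, l` have the values `c, a, b`. A choice of distinct
`j, k, l` is given as the permutation `σ` with `j = σ 0`, `k = σ 1`, `l = σ 2`. -/
def label (σ : Equiv.Perm (Fin 3)) (c a b : Fin 2) : Bits3 :=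
  fun i => ![c, a, b] (σ.symm i)

/-- The reduced state `ρ_j = Tr_{kl} ρ₁₂₃` of the controller. -/
def controllerState (ρ : Op3) (σ : Equiv.Perm (Fin 3)) : Op1 :=
  Matrix.of fun c c' => ∑ a, ∑ b, ρ (label σ c a b) (label σ c' a b)

/-- The reduced state `ρ_{kl} = Tr_j ρ₁₂₃` of the sender (qubit `k`) and the receiver
(qubit `l`). -/
def pairState (ρ : Op3) (σ : Equiv.Perm (Fin 3)) : Op2 :=
  Matrix.of fun p q => ∑ c, ρ (label σ c p.1 p.2) (label σ c q.1 q.2)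

/-- The probability `⟨i| U ρ_j U† |i⟩` of the controller's outcome `i`, when the controller measures
qubit `j` in the basis `U†|0⟩, U†|1⟩`. -/
def outcomeProb (ρ : Op3) (σ : Equiv.Perm (Fin 3)) (U : Op1) (i : Fin 2) : ℝ :=
  ((U * controllerState ρ σ * Uᴴ) i i).re

/-- The state `ρ_{kl}^i = (⟨i|U ⊗ 1) ρ (U†|i⟩ ⊗ 1) / p_i` of sender and receiver after the outcome
`i`, with `p_i` the probability of that outcome. -/
def postState (ρ : Op3) (σ : Equiv.Perm (Fin 3)) (U : Op1) (i : Fin 2) : Op2 :=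
  ((outcomeProb ρ σ U i : ℂ)⁻¹) • Matrix.of fun p q =>
    ∑ c, ∑ c', U i c * ρ (label σ c p.1 p.2) (label σ c' q.1 q.2) * star (U i c')

/-- The average dense coding capacity of sender and receiver, if the controller measures in the
basis `U†|0⟩, U†|1⟩` and announces the outcome. -/
def averageCapacity (ρ : Op3) (σ : Equiv.Perm (Fin 3)) (U : Op1) : ℝ :=
  ∑ i, outcomeProb ρ σ U i * capacity (postState ρ σ U i)

/-- The controlled dense coding capacity `C_CD^{jkl}(ρ)`: the largest average capacity over all
`2 × 2` unitary matrices. -/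
def controlledCapacity (ρ : Op3) (σ : Equiv.Perm (Fin 3)) : ℝ :=
  ⨆ U : Matrix.unitaryGroup (Fin 2) ℂ, averageCapacity ρ σ U

/-- The control power `P^{jkl}(ρ) = C_CD^{jkl}(ρ) - C(ρ_{kl})`. -/
def controlPower (ρ : Op3) (σ : Equiv.Perm (Fin 3)) : ℝ :=
  controlledCapacity ρ σ - capacity (pairState ρ σ)

/-- The minimal control power: the minimum of `P^{jkl}(ρ)` over all permutations. -/
def minimalControlPower (ρ : Op3) : ℝ :=
  Finset.univ.inf' Finset.univ_nonempty (controlPower ρ)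

/-- The computational basis vector `|x₁x₂x₃⟩`. -/
def ket (x : Bits3) : Bits3 → ℂ := Pi.single x 1

/-- The density matrix `|ψ⟩⟨ψ|`. -/
def pureState (ψ : Bits3 → ℂ) : Op3 := Matrix.vecMulVec ψ (star ψ)

/-- The generalized W vector `λ₁|100⟩ + λ₂|010⟩ + λ₃|001⟩`. -/
def generalizedW (lam : Fin 3 → ℝ) : Bits3 → ℂ :=
  (lam 0 : ℂ) • ket ![1, 0, 0] + (lam 1 : ℂ) • ket ![0, 1, 0] + (lam 2 : ℂ) • ket ![0, 0, 1]

/-- The vector is a product of a vector of some qubit `j` and a vector of the two other qubits `k`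
and `l`, which may itself be entangled or a product: the pure state is biseparable or fully
separable. -/
def IsBiseparableOrFullySeparable (ψ : Bits3 → ℂ) : Prop :=
  ∃ (σ : Equiv.Perm (Fin 3)) (φ : Fin 2 → ℂ) (χ : Fin 2 → Fin 2 → ℂ),
    ∀ c a b, ψ (label σ c a b) = φ c * χ a b

end

end DenseCoding

/-!
Whatever the controller measures on a pure state, each outcome leaves sender and receiver in a pure
state, whose capacity is `1 + E(C)`, where `E(C)` is the entanglement entropy as a function of the
concurrence `C`.

Let `q₀ = λ_k² + λ_l²`, and let `C₀ = 2 |λ_k λ_l| / q₀` be the concurrence left by the outcome `0`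
in the computational basis. For a unitary `U = (u_ic)`, the outcome `i` has a probability
`p ≥ q = |u_i0|² q₀`, and its concurrence `C` satisfies `p C = q C₀`. Since `E(C) / C` increases
with `C`, this gives `p E(C) ≤ q E(C₀)`. The values of `q` sum to `q₀`, because the columns of `U`
are unit vectors, so that the average capacity is at most `1 + q₀ E(C₀)`, with equality at `U = 1`.

By the grouping property of the entropy, the control power is the entropy of the distribution
`(λ₁², λ₂², λ₃²)` minus `h(λ_l²)`, hence smallest where `λ_l²` is largest.
-/

namespace DenseCoding

section BinaryEntropy

variable {x y z : ℝ}

lemma binaryEntropy_eq_binEntropy_div (x : ℝ) :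
    binaryEntropy x = Real.binEntropy x / Real.log 2 := by
  rw [binaryEntropy, Real.binEntropy_eq_negMulLog_add_negMulLog_one_sub, Real.negMulLog,
    Real.negMulLog, Real.logb, Real.logb]
  ring

lemma binaryEntropy_one_sub (x : ℝ) : binaryEntropy (1 - x) = binaryEntropy x := by
  rw [binaryEntropy_eq_binEntropy_div, binaryEntropy_eq_binEntropy_div, Real.binEntropy_one_sub]

lemma binaryEntropy_nonneg (hx0 : 0 ≤ x) (hx1 : x ≤ 1) : 0 ≤ binaryEntropy x := by
  rw [binaryEntropy_eq_binEntropy_div]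
  exact div_nonneg (Real.binEntropy_nonneg hx0 hx1) (Real.log_pos one_lt_two).le

lemma binaryEntropy_eq_zero : binaryEntropy x = 0 ↔ x = 0 ∨ x = 1 := by
  rw [binaryEntropy_eq_binEntropy_div, div_eq_zero_iff, Real.binEntropy_eq_zero,
    or_iff_left (Real.log_pos one_lt_two).ne']

lemma binaryEntropy_le_binaryEntropy (hx : 0 ≤ x) (hxy : x ≤ y) (hxy' : x ≤ 1 - y) :
    binaryEntropy x ≤ binaryEntropy y := by
  wlog hy : y ≤ 2⁻¹ generalizing y
  · rw [← binaryEntropy_one_sub y]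
    exact this hxy' (by linarith) (by linarith)
  rw [binaryEntropy_eq_binEntropy_div, binaryEntropy_eq_binEntropy_div]
  have hmono := Real.binEntropy_strictMonoOn.monotoneOn ⟨hx, hxy.trans hy⟩ ⟨hx.trans hxy, hy⟩ hxy
  exact div_le_div_of_nonneg_right hmono (Real.log_pos one_lt_two).le

lemma add_mul_binaryEntropy_div_add (hy : 0 ≤ y) (hz : 0 ≤ z) :
    (y + z) * binaryEntropy (y / (y + z)) =
      (Real.negMulLog y + Real.negMulLog z - Real.negMulLog (y + z)) / Real.log 2 := by
  rcases (add_nonneg hy hz).eq_or_lt with hsum | hsum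
  · obtain rfl : y = 0 := by linarith
    obtain rfl : z = 0 := by linarith
    simp
  have hcompl : 1 - y / (y + z) = z / (y + z) := by field_simp; ring
  have hscale (t : ℝ) : (y + z) * Real.negMulLog (t / (y + z)) =
      Real.negMulLog t - t / (y + z) * Real.negMulLog (y + z) := by
    rw [eq_sub_iff_add_eq, ← Real.negMulLog_mul, div_mul_cancel₀ t hsum.ne']
  rw [binaryEntropy_eq_binEntropy_div, Real.binEntropy_eq_negMulLog_add_negMulLog_one_sub, hcompl,
    ← mul_div_assoc, mul_add, hscale, hscale]
  field_simp
  ring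

lemma add_mul_binaryEntropy_div_add_nonneg (hy : 0 ≤ y) (hz : 0 ≤ z) :
    0 ≤ (y + z) * binaryEntropy (y / (y + z)) :=
  mul_nonneg (add_nonneg hy hz) <| binaryEntropy_nonneg (div_nonneg hy (add_nonneg hy hz))
    (div_le_one_of_le₀ (le_add_of_nonneg_right hz) (add_nonneg hy hz))

lemma add_mul_binaryEntropy_div_add_eq_zero_iff (hy : 0 ≤ y) (hz : 0 ≤ z) :
    (y + z) * binaryEntropy (y / (y + z)) = 0 ↔ y = 0 ∨ z = 0 := by
  rcases (add_nonneg hy hz).eq_or_lt with hsum | hsum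
  · have hy0 : y = 0 := by linarith
    rw [← hsum, zero_mul]
    exact iff_of_true rfl (Or.inl hy0)
  · rw [mul_eq_zero, or_iff_right hsum.ne', binaryEntropy_eq_zero, div_eq_zero_iff,
      or_iff_left hsum.ne', div_eq_one_iff_eq hsum.ne', left_eq_add]

end BinaryEntropy

section EntropyOfConcurrence

variable {x C t : ℝ}

lemma negMulLog_one_sub_le_negMulLog (hx0 : 0 < x) (hx1 : x ≤ 1 / 2) :
    Real.negMulLog (1 - x) ≤ Real.negMulLog x := by
  have hpos : 0 < 1 - x := by linarith
  -- `1 - x` is the convex combination of `1` and `x` with weights `(1 - 2 * x) / (1 - x)` and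
  -- `x / (1 - x)`.
  have hlog := strictConcaveOn_log_Ioi.concaveOn.2 (Set.mem_Ioi.mpr one_pos) (Set.mem_Ioi.mpr hx0)
    (div_nonneg (by linarith : 0 ≤ 1 - 2 * x) hpos.le) (div_nonneg hx0.le hpos.le)
    (by field_simp; ring)
  have hcomb : (1 - 2 * x) / (1 - x) * 1 + x / (1 - x) * x = 1 - x := by field_simp; ring
  rw [smul_eq_mul, smul_eq_mul, smul_eq_mul, smul_eq_mul, hcomb, Real.log_one, mul_zero, zero_add,
    div_mul_eq_mul_div, div_le_iff₀ hpos] at hlog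
  rw [Real.negMulLog, Real.negMulLog]
  linarith

lemma hasDerivAt_binEntropy_div_sqrt (hx0 : 0 < x) (hx1 : x < 1) :
    HasDerivAt (fun x => Real.binEntropy x / √(x * (1 - x)))
      ((Real.negMulLog x - Real.negMulLog (1 - x)) / (2 * √(x * (1 - x)) ^ 3)) x := by
  have hpos : 0 < x * (1 - x) := mul_pos hx0 (by linarith)
  have hsqrt : 0 < √(x * (1 - x)) := Real.sqrt_pos.mpr hpos
  have hsq : √(x * (1 - x)) ^ 2 = x * (1 - x) := Real.sq_sqrt hpos.le
  have hprod : HasDerivAt (fun x : ℝ => x * (1 - x)) (1 - 2 * x) x :=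
    ((hasDerivAt_id' x).mul ((hasDerivAt_id' x).const_sub 1)).congr_deriv (by ring)
  refine ((Real.hasDerivAt_binEntropy hx0.ne' hx1.ne).div (hprod.sqrt hpos.ne')
    hsqrt.ne').congr_deriv ?_
  rw [Real.binEntropy_eq_negMulLog_add_negMulLog_one_sub, Real.negMulLog, Real.negMulLog]
  field_simp
  rw [hsq]
  ring

lemma monotoneOn_binEntropy_div_sqrt :
    MonotoneOn (fun x => Real.binEntropy x / √(x * (1 - x))) (Set.Ioc 0 (1 / 2)) := by
  have hderiv (x : ℝ) (hx : x ∈ Set.Ioc (0 : ℝ) (1 / 2)) :=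
    hasDerivAt_binEntropy_div_sqrt hx.1 (hx.2.trans_lt one_half_lt_one)
  refine monotoneOn_of_deriv_nonneg (convex_Ioc _ _) (HasDerivAt.continuousOn hderiv)
    (fun x hx => (hderiv x (interior_subset hx)).differentiableAt.differentiableWithinAt)
    fun x hx => ?_
  obtain ⟨hx0, hx1⟩ := interior_subset hx
  rw [(hderiv x ⟨hx0, hx1⟩).deriv]
  exact div_nonneg (sub_nonneg.mpr (negMulLog_one_sub_le_negMulLog hx0 hx1)) (by positivity)

/-- The smaller eigenvalue of either reduced state of a pure two-qubit state of concurrence `C`,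
that is, the smaller root of `x * (1 - x) = C ^ 2 / 4`. -/
noncomputable def smallerEigenvalue (C : ℝ) : ℝ := (1 - √(1 - C ^ 2)) / 2

lemma smallerEigenvalue_mem_Ioc (hC : C ∈ Set.Ioc 0 1) :
    smallerEigenvalue C ∈ Set.Ioc 0 (1 / 2) := by
  have hlt : √(1 - C ^ 2) < 1 := by
    rw [Real.sqrt_lt' one_pos]
    linarith [pow_pos hC.1 2]
  rw [smallerEigenvalue]
  constructor <;> linarith [Real.sqrt_nonneg (1 - C ^ 2)]

lemma monotoneOn_smallerEigenvalue : MonotoneOn smallerEigenvalue (Set.Ici 0) := by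
  intro C hC D _ hCD
  rw [smallerEigenvalue, smallerEigenvalue]
  gcongr

lemma sqrt_smallerEigenvalue_mul_one_sub (hC0 : 0 ≤ C) (hC1 : C ≤ 1) :
    √(smallerEigenvalue C * (1 - smallerEigenvalue C)) = C / 2 := by
  have hsq : √(1 - C ^ 2) ^ 2 = 1 - C ^ 2 := Real.sq_sqrt (sub_nonneg.mpr (pow_le_one₀ hC0 hC1))
  have hprod : smallerEigenvalue C * (1 - smallerEigenvalue C) = (C / 2) ^ 2 := by
    rw [smallerEigenvalue]
    linear_combination -(1 / 4) * hsq
  rw [hprod, Real.sqrt_sq (by positivity)]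

/-- The entanglement entropy of a pure two-qubit state as a function of its concurrence `C`. -/
noncomputable def entropyOfConcurrence (C : ℝ) : ℝ := binaryEntropy (smallerEigenvalue C)

lemma entropyOfConcurrence_eq_binaryEntropy (h : C ^ 2 = 4 * (x * (1 - x))) :
    entropyOfConcurrence C = binaryEntropy x := by
  have hsqrt : √(1 - C ^ 2) = |1 - 2 * x| := by
    rw [← Real.sqrt_sq_eq_abs, h]
    ring_nf
  rw [entropyOfConcurrence, smallerEigenvalue, hsqrt]
  rcases abs_choice (1 - 2 * x) with habs | habs <;> rw [habs]
  · ring_nf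
  · rw [← binaryEntropy_one_sub]
    ring_nf

lemma entropyOfConcurrence_zero : entropyOfConcurrence 0 = 0 := by
  rw [entropyOfConcurrence_eq_binaryEntropy (x := 0) (by ring), binaryEntropy_eq_zero]
  exact Or.inl rfl

lemma entropyOfConcurrence_two_mul_abs_mul_div (a b : ℝ) :
    entropyOfConcurrence (2 * |a * b| / (a ^ 2 + b ^ 2)) =
      binaryEntropy (a ^ 2 / (a ^ 2 + b ^ 2)) := by
  apply entropyOfConcurrence_eq_binaryEntropy
  rw [div_pow, mul_pow, sq_abs]
  rcases (add_nonneg (sq_nonneg a) (sq_nonneg b)).eq_or_lt with hsum | hsum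
  · simp [← hsum]
  · field_simp
    ring

lemma entropyOfConcurrence_div_eq (hC0 : 0 ≤ C) (hC1 : C ≤ 1) :
    entropyOfConcurrence C / C = Real.binEntropy (smallerEigenvalue C) /
      √(smallerEigenvalue C * (1 - smallerEigenvalue C)) / (2 * Real.log 2) := by
  rw [sqrt_smallerEigenvalue_mul_one_sub hC0 hC1, entropyOfConcurrence,
    binaryEntropy_eq_binEntropy_div]
  field_simp

lemma monotoneOn_entropyOfConcurrence_div :
    MonotoneOn (fun C => entropyOfConcurrence C / C) (Set.Ioc 0 1) := by
  intro C hC D hD hCD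
  simp only [entropyOfConcurrence_div_eq hC.1.le hC.2, entropyOfConcurrence_div_eq hD.1.le hD.2]
  exact div_le_div_of_nonneg_right
    (monotoneOn_binEntropy_div_sqrt (smallerEigenvalue_mem_Ioc hC) (smallerEigenvalue_mem_Ioc hD)
      (monotoneOn_smallerEigenvalue hC.1.le hD.1.le hCD))
    (mul_pos two_pos (Real.log_pos one_lt_two)).le

lemma entropyOfConcurrence_mul_le (ht0 : 0 ≤ t) (ht1 : t ≤ 1) (hC0 : 0 ≤ C) (hC1 : C ≤ 1) :
    entropyOfConcurrence (t * C) ≤ t * entropyOfConcurrence C := by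
  rcases ht0.eq_or_lt with rfl | ht
  · simp [entropyOfConcurrence_zero]
  rcases hC0.eq_or_lt with rfl | hC
  · simp [entropyOfConcurrence_zero]
  have htC : t * C ≤ C := mul_le_of_le_one_left hC0 ht1
  have hmono := monotoneOn_entropyOfConcurrence_div ⟨mul_pos ht hC, htC.trans hC1⟩ ⟨hC, hC1⟩ htC
  rwa [div_le_iff₀ (mul_pos ht hC), mul_left_comm, div_mul_cancel₀ _ hC.ne'] at hmono

lemma mul_entropyOfConcurrence_mul_div_le {a b s p : ℝ} (hs : 0 ≤ s)
    (hp : s * (a ^ 2 + b ^ 2) ≤ p) :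
    p * entropyOfConcurrence (s * (2 * |a * b|) / p) ≤
      s * ((a ^ 2 + b ^ 2) * binaryEntropy (a ^ 2 / (a ^ 2 + b ^ 2))) := by
  set B := a ^ 2 + b ^ 2 with hB
  have hB0 : 0 ≤ B := by positivity
  have hab : 2 * |a * b| ≤ B := by
    rw [abs_mul, ← mul_assoc, hB, ← sq_abs a, ← sq_abs b]
    exact two_mul_le_add_sq _ _
  have hab0 : 0 ≤ 2 * |a * b| := by positivity
  have hp0 : 0 ≤ p := (mul_nonneg hs hB0).trans hp
  have hscale : s * (2 * |a * b|) / p = s * B / p * (2 * |a * b| / B) := by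
    rw [div_mul_eq_mul_div, mul_assoc, mul_div_cancel_of_imp' fun h => by linarith]
  have hcancel : p * (s * B / p) = s * B :=
    mul_div_cancel_of_imp' fun h => le_antisymm (hp.trans_eq h) (mul_nonneg hs hB0)
  calc p * entropyOfConcurrence (s * (2 * |a * b|) / p)
      ≤ p * (s * B / p * entropyOfConcurrence (2 * |a * b| / B)) := by
        rw [hscale]
        exact mul_le_mul_of_nonneg_left (entropyOfConcurrence_mul_le (by positivity)
          (div_le_one_of_le₀ hp hp0) (by positivity) (div_le_one_of_le₀ hab hB0)) hp0
    _ = s * (B * binaryEntropy (a ^ 2 / B)) := by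
        rw [← mul_assoc, hcancel, hB, entropyOfConcurrence_two_mul_abs_mul_div, mul_assoc]

end EntropyOfConcurrence

section VonNeumannEntropy

open scoped Matrix

lemma trace_cfc {𝕜 n : Type*} [RCLike 𝕜] [Fintype n] [DecidableEq n] {A : Matrix n n 𝕜}
    (hA : A.IsHermitian) (f : ℝ → ℝ) : (cfc f A).trace = ∑ i, (f (hA.eigenvalues i) : 𝕜) := by
  rw [hA.cfc_eq, Matrix.IsHermitian.cfc, Unitary.conjStarAlgAut_apply, Matrix.trace_mul_comm,
    ← mul_assoc, Unitary.coe_star_mul_self, one_mul, Matrix.trace_diagonal]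
  rfl

variable {m n : Type} [Fintype m] [DecidableEq m] [Fintype n] [DecidableEq n]

lemma vonNeumannEntropy_eq_sum_eigenvalues {ρ : Matrix n n ℂ} (hρ : ρ.IsHermitian) :
    vonNeumannEntropy ρ = (∑ i, Real.negMulLog (hρ.eigenvalues i)) / Real.log 2 := by
  have hcont (f : ℝ → ℝ) : ContinuousOn f (spectrum ℝ ρ) := ρ.finite_real_spectrum.continuousOn f
  have hmul : ρ * cfc (Real.logb 2) ρ = cfc (fun x => x * Real.logb 2 x) ρ := by
    rw [cfc_mul (fun x => x) (Real.logb 2) ρ (hcont _) (hcont _), cfc_id' ℝ ρ hρ.isSelfAdjoint]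
  rw [vonNeumannEntropy, hmul, trace_cfc hρ]
  simp only [Complex.coe_algebraMap]
  rw [← Complex.ofReal_sum, Complex.ofReal_re, ← Finset.sum_neg_distrib, Finset.sum_div]
  refine Finset.sum_congr rfl fun i _ => ?_
  rw [Real.negMulLog, Real.logb]
  ring

lemma vonNeumannEntropy_eq_sum_roots_charpoly {ρ : Matrix n n ℂ} (hρ : ρ.IsHermitian) :
    vonNeumannEntropy ρ =
      (ρ.charpoly.roots.map fun z => Real.negMulLog z.re).sum / Real.log 2 := by
  rw [vonNeumannEntropy_eq_sum_eigenvalues hρ, hρ.roots_charpoly_eq_eigenvalues, Multiset.map_map]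
  rfl

lemma vonNeumannEntropy_transpose {ρ : Matrix n n ℂ} (hρ : ρ.IsHermitian) :
    vonNeumannEntropy ρᵀ = vonNeumannEntropy ρ := by
  rw [vonNeumannEntropy_eq_sum_roots_charpoly hρ.transpose, Matrix.charpoly_transpose,
    vonNeumannEntropy_eq_sum_roots_charpoly hρ]

lemma vonNeumannEntropy_diagonal (d : n → ℝ) :
    vonNeumannEntropy (Matrix.diagonal fun i => (d i : ℂ)) =
      (∑ i, Real.negMulLog (d i)) / Real.log 2 := by
  have hherm : (Matrix.diagonal fun i => (d i : ℂ)).IsHermitian :=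
    Matrix.isHermitian_diagonal_of_self_adjoint _ (funext fun i => Complex.conj_ofReal (d i))
  rw [vonNeumannEntropy_eq_sum_roots_charpoly hherm, Matrix.charpoly_diagonal,
    Polynomial.roots_prod _ _ (Finset.prod_ne_zero_iff.mpr fun i _ => Polynomial.X_sub_C_ne_zero _)]
  simp only [Polynomial.roots_X_sub_C, Multiset.bind_singleton, Multiset.map_map,
    Function.comp_apply, Complex.ofReal_re]
  rfl

lemma vonNeumannEntropy_mul_comm (A : Matrix m n ℂ) (B : Matrix n m ℂ)
    (hAB : (A * B).IsHermitian) (hBA : (B * A).IsHermitian) :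
    vonNeumannEntropy (A * B) = vonNeumannEntropy (B * A) := by
  have hne {l : Type} [Fintype l] [DecidableEq l] (k : ℕ) (M : Matrix l l ℂ) :
      Polynomial.X ^ k * M.charpoly ≠ 0 :=
    mul_ne_zero (pow_ne_zero k Polynomial.X_ne_zero) M.charpoly_monic.ne_zero
  have hroots := congrArg (fun p => (p.roots.map fun z : ℂ => Real.negMulLog z.re).sum)
    (Matrix.charpoly_mul_comm' A B)
  -- The extra roots on either side are zeros, to which `negMulLog` assigns `0`.
  simp only [Polynomial.roots_mul (hne _ _), Polynomial.roots_X_pow, Multiset.map_add,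
    Multiset.sum_add, Multiset.map_nsmul, Multiset.sum_nsmul, Multiset.map_singleton,
    Multiset.sum_singleton, Complex.zero_re, Real.negMulLog_zero, smul_zero, zero_add] at hroots
  rw [vonNeumannEntropy_eq_sum_roots_charpoly hAB, vonNeumannEntropy_eq_sum_roots_charpoly hBA,
    hroots]

lemma vonNeumannEntropy_one : vonNeumannEntropy (1 : Matrix n n ℂ) = 0 := by
  rw [vonNeumannEntropy, one_mul, cfc_apply_one, Real.logb_one]
  simp

lemma vonNeumannEntropy_smul_vecMulVec_star {v : n → ℂ} {r : ℝ}
    (hv : (r : ℂ) * (star v ⬝ᵥ v) = 1) :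
    vonNeumannEntropy ((r : ℂ) • Matrix.vecMulVec v (star v)) = 0 := by
  have hfactor : (r : ℂ) • Matrix.vecMulVec v (star v) =
      Matrix.replicateCol Unit ((r : ℂ) • v) * Matrix.replicateRow Unit (star v) := by
    rw [← Matrix.smul_vecMulVec, Matrix.vecMulVec_eq Unit]
  have hone : Matrix.replicateRow Unit (star v) * Matrix.replicateCol Unit ((r : ℂ) • v) = 1 := by
    ext
    rw [Matrix.replicateRow_mul_replicateCol_apply, dotProduct_smul, smul_eq_mul, hv,
      Matrix.one_apply_eq]
  have hherm : ((r : ℂ) • Matrix.vecMulVec v (star v)).IsHermitian := by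
    rw [Matrix.IsHermitian, Matrix.conjTranspose_smul, Matrix.conjTranspose_vecMulVec, star_star,
      Complex.star_def, Complex.conj_ofReal]
  rw [hfactor, vonNeumannEntropy_mul_comm _ _ (hfactor ▸ hherm) (hone ▸ Matrix.isHermitian_one),
    hone, vonNeumannEntropy_one]

lemma vonNeumannEntropy_eq_entropyOfConcurrence {ρ : Op1} (hρ : ρ.IsHermitian)
    (htrace : ρ.trace = 1) {C : ℝ} (hdet : 4 * ρ.det = ((C ^ 2 : ℝ) : ℂ)) :
    vonNeumannEntropy ρ = entropyOfConcurrence C := by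
  have hsum : hρ.eigenvalues 0 + hρ.eigenvalues 1 = 1 := by
    rw [hρ.trace_eq_sum_eigenvalues, Fin.sum_univ_two] at htrace
    exact Complex.ofReal_injective (by simpa using htrace)
  have hone_sub : hρ.eigenvalues 1 = 1 - hρ.eigenvalues 0 := by linarith
  have hprod : C ^ 2 = 4 * (hρ.eigenvalues 0 * (1 - hρ.eigenvalues 0)) := by
    rw [hρ.det_eq_prod_eigenvalues, Fin.prod_univ_two, hone_sub] at hdet
    exact Complex.ofReal_injective (by simpa using hdet.symm)
  rw [entropyOfConcurrence_eq_binaryEntropy hprod, vonNeumannEntropy_eq_sum_eigenvalues hρ,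
    Fin.sum_univ_two, hone_sub, binaryEntropy_eq_binEntropy_div,
    Real.binEntropy_eq_negMulLog_add_negMulLog_one_sub]

end VonNeumannEntropy

section PureState

open scoped Matrix

lemma star_dotProduct_self {𝕜 n : Type*} [RCLike 𝕜] [Fintype n] (v : n → 𝕜) :
    star v ⬝ᵥ v = ((∑ i, ‖v i‖ ^ 2 : ℝ) : 𝕜) := by
  simp only [dotProduct, Pi.star_apply, RCLike.star_def, RCLike.conj_mul]
  push_cast
  rfl

lemma sum_norm_sq_col_of_mem_unitaryGroup {𝕜 n : Type*} [RCLike 𝕜] [Fintype n] [DecidableEq n]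
    {U : Matrix n n 𝕜} (hU : U ∈ Matrix.unitaryGroup n 𝕜) (j : n) : ∑ i, ‖U i j‖ ^ 2 = 1 := by
  have hcol : (star U * U) j j = 1 := by
    rw [Matrix.mem_unitaryGroup_iff'.mp hU, Matrix.one_apply_eq]
  have hdot : (star U * U) j j = star (U.col j) ⬝ᵥ U.col j := rfl
  rw [hdot, star_dotProduct_self] at hcol
  exact_mod_cast hcol

lemma sum_outcomeProb (ρ : Op3) (σ : Equiv.Perm (Fin 3)) {U : Op1}
    (hU : U ∈ Matrix.unitaryGroup (Fin 2) ℂ) :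
    ∑ i, outcomeProb ρ σ U i = (controllerState ρ σ).trace.re := by
  have htrace : (U * controllerState ρ σ * Uᴴ).trace = (controllerState ρ σ).trace := by
    rw [Matrix.trace_mul_cycle, ← Matrix.star_eq_conjTranspose, Matrix.mem_unitaryGroup_iff'.mp hU,
      one_mul]
  rw [← htrace, Matrix.trace, Complex.re_sum]
  rfl

lemma traceFirst_pairState (ρ : Op3) (σ : Equiv.Perm (Fin 3)) :
    traceFirst (pairState ρ σ) = controllerState ρ (σ * Equiv.swap 0 2) := by
  have hlabel (a b c : Fin 2) : label (σ * Equiv.swap 0 2) b a c = label σ c a b := by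
    ext i
    obtain ⟨k, rfl⟩ := σ.surjective i
    fin_cases k <;> simp [label, Equiv.Perm.mul_def, Equiv.swap_apply_of_ne_of_ne]
  ext b b'
  simp only [traceFirst, pairState, controllerState, Matrix.of_apply, hlabel]

/-- The amplitudes of a three-qubit vector, with the controller's qubit as row index and the qubits
of sender and receiver as column index. -/
def amplitudeMatrix (ψ : Bits3 → ℂ) (σ : Equiv.Perm (Fin 3)) : Matrix (Fin 2) (Fin 2 × Fin 2) ℂ :=
  Matrix.of fun c p => ψ (label σ c p.1 p.2)

variable (ψ : Bits3 → ℂ) (σ : Equiv.Perm (Fin 3)) (U : Op1) (i : Fin 2)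

lemma controllerState_pureState :
    controllerState (pureState ψ) σ = amplitudeMatrix ψ σ * (amplitudeMatrix ψ σ)ᴴ := by
  ext c c'
  rw [Matrix.mul_apply, Fintype.sum_prod_type]
  rfl

lemma pairState_pureState :
    pairState (pureState ψ) σ = ((amplitudeMatrix ψ σ)ᴴ * amplitudeMatrix ψ σ)ᵀ := by
  ext p q
  rw [pairState, Matrix.of_apply, Matrix.transpose_apply, Matrix.mul_apply]
  exact Finset.sum_congr rfl fun c _ => mul_comm _ _

lemma vonNeumannEntropy_pairState_pureState :
    vonNeumannEntropy (pairState (pureState ψ) σ) =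
      vonNeumannEntropy (controllerState (pureState ψ) σ) := by
  rw [pairState_pureState, controllerState_pureState,
    vonNeumannEntropy_transpose (Matrix.isHermitian_conjTranspose_mul_self _),
    vonNeumannEntropy_mul_comm _ _ (Matrix.isHermitian_conjTranspose_mul_self _)
      (Matrix.isHermitian_mul_conjTranspose_self _)]

lemma capacity_pairState_pureState :
    capacity (pairState (pureState ψ) σ) =
      1 + vonNeumannEntropy (controllerState (pureState ψ) (σ * Equiv.swap 0 2)) -
        vonNeumannEntropy (controllerState (pureState ψ) σ) := by
  rw [capacity, traceFirst_pairState, vonNeumannEntropy_pairState_pureState]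

lemma outcomeProb_pureState :
    outcomeProb (pureState ψ) σ U i = ∑ p, ‖(U * amplitudeMatrix ψ σ) i p‖ ^ 2 := by
  have hfactor : U * controllerState (pureState ψ) σ * Uᴴ =
      (U * amplitudeMatrix ψ σ) * (U * amplitudeMatrix ψ σ)ᴴ := by
    simp only [controllerState_pureState, Matrix.conjTranspose_mul, Matrix.mul_assoc]
  rw [outcomeProb, hfactor, Matrix.mul_apply, Complex.re_sum]
  refine Finset.sum_congr rfl fun p _ => ?_
  rw [Matrix.conjTranspose_apply, Complex.star_def, Complex.mul_conj', ← Complex.ofReal_pow,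
    Complex.ofReal_re]

lemma postState_pureState :
    postState (pureState ψ) σ U i = (outcomeProb (pureState ψ) σ U i : ℂ)⁻¹ •
      Matrix.vecMulVec ((U * amplitudeMatrix ψ σ) i) (star ((U * amplitudeMatrix ψ σ) i)) := by
  rw [postState]
  congr 1
  ext p q
  simp only [Matrix.of_apply, Matrix.vecMulVec_apply, Pi.star_apply, Matrix.mul_apply,
    amplitudeMatrix, pureState, star_sum, star_mul', Finset.sum_mul_sum]
  exact Finset.sum_congr rfl fun c _ => Finset.sum_congr rfl fun c' _ => by ring

/-- The concurrence of a pure two-qubit state; it scales with the squared norm of the vector. -/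
noncomputable def concurrence (φ : Fin 2 × Fin 2 → ℂ) : ℝ :=
  2 * ‖φ (0, 0) * φ (1, 1) - φ (0, 1) * φ (1, 0)‖

lemma traceFirst_vecMulVec_star (φ : Fin 2 × Fin 2 → ℂ) (r : ℂ) :
    traceFirst (r • Matrix.vecMulVec φ (star φ)) =
      r • (Matrix.of (fun b a => φ (a, b)) * (Matrix.of fun b a => φ (a, b))ᴴ) := by
  ext b b'
  simp only [traceFirst, Matrix.of_apply, Matrix.smul_apply, Matrix.mul_apply,
    Matrix.vecMulVec_apply, Matrix.conjTranspose_apply, Pi.star_apply, Finset.smul_sum]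

lemma capacity_inv_smul_vecMulVec_star {φ : Fin 2 × Fin 2 → ℂ} {p : ℝ} (hp : p ≠ 0)
    (hφ : ∑ x, ‖φ x‖ ^ 2 = p) :
    capacity ((p : ℂ)⁻¹ • Matrix.vecMulVec φ (star φ)) =
      1 + entropyOfConcurrence (concurrence φ / p) := by
  have hpC : (p : ℂ) ≠ 0 := Complex.ofReal_ne_zero.mpr hp
  have hdot : star φ ⬝ᵥ φ = p := by rw [star_dotProduct_self, hφ]; rfl
  have hpure : vonNeumannEntropy ((p : ℂ)⁻¹ • Matrix.vecMulVec φ (star φ)) = 0 := by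
    rw [← Complex.ofReal_inv]
    exact vonNeumannEntropy_smul_vecMulVec_star
      (by rw [hdot, Complex.ofReal_inv, inv_mul_cancel₀ hpC])
  let M : Op1 := Matrix.of fun b a => φ (a, b)
  have hreduced : traceFirst ((p : ℂ)⁻¹ • Matrix.vecMulVec φ (star φ)) = (p : ℂ)⁻¹ • (M * Mᴴ) :=
    traceFirst_vecMulVec_star φ _
  have hherm : ((p : ℂ)⁻¹ • (M * Mᴴ)).IsHermitian := by
    rw [Matrix.IsHermitian, Matrix.conjTranspose_smul, Matrix.isHermitian_mul_conjTranspose_self,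
      star_inv₀, Complex.star_def, Complex.conj_ofReal]
  have htrace : ((p : ℂ)⁻¹ • (M * Mᴴ)).trace = 1 := by
    rw [Matrix.trace_smul, Matrix.trace_mul_comm, ← Matrix.star_vec_dotProduct_vec, smul_eq_mul,
      show M.vec = φ from rfl, hdot, inv_mul_cancel₀ hpC]
  have hdet : 4 * ((p : ℂ)⁻¹ • (M * Mᴴ)).det = (((concurrence φ / p) ^ 2 : ℝ) : ℂ) := by
    have hM : concurrence φ = 2 * ‖M.det‖ := by
      rw [Matrix.det_fin_two, concurrence]
      congr 3
      exact mul_comm _ _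
    rw [Matrix.det_smul, Matrix.det_mul, Matrix.det_conjTranspose, Complex.star_def,
      Complex.mul_conj', hM, Fintype.card_fin]
    push_cast
    ring
  rw [capacity, hpure, hreduced, vonNeumannEntropy_eq_entropyOfConcurrence hherm htrace hdet,
    sub_zero]

lemma averageCapacity_pureState :
    averageCapacity (pureState ψ) σ U = ∑ i, (outcomeProb (pureState ψ) σ U i +
      outcomeProb (pureState ψ) σ U i * entropyOfConcurrence
        (concurrence ((U * amplitudeMatrix ψ σ) i) / outcomeProb (pureState ψ) σ U i)) := by
  refine Finset.sum_congr rfl fun i _ => ?_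
  rcases eq_or_ne (outcomeProb (pureState ψ) σ U i) 0 with hp | hp
  · rw [hp, zero_mul, zero_mul, add_zero]
  · rw [postState_pureState,
      capacity_inv_smul_vecMulVec_star hp (outcomeProb_pureState ψ σ U i).symm, mul_add, mul_one]

end PureState

section GeneralizedW

variable {lam : Fin 3 → ℝ} (σ : Equiv.Perm (Fin 3)) (U : Op1) (i : Fin 2)

lemma generalizedW_apply (lam : Fin 3 → ℝ) (x : Bits3) :
    generalizedW lam x = ∑ i, if x = Pi.single i 1 then (lam i : ℂ) else 0 := by
  have h0 : (![1, 0, 0] : Bits3) = Pi.single 0 1 := by decide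
  have h1 : (![0, 1, 0] : Bits3) = Pi.single 1 1 := by decide
  have h2 : (![0, 0, 1] : Bits3) = Pi.single 2 1 := by decide
  simp only [generalizedW, ket, h0, h1, h2, Fin.sum_univ_three, Pi.add_apply, Pi.smul_apply,
    Pi.single_apply, smul_eq_mul, mul_ite, mul_one, mul_zero]

lemma generalizedW_comp_symm (lam : Fin 3 → ℝ) (x : Bits3) :
    generalizedW lam (x ∘ σ.symm) = generalizedW (lam ∘ σ) x := by
  have hsingle (i : Fin 3) : x ∘ σ.symm = Pi.single (σ i) 1 ↔ x = Pi.single i 1 := by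
    rw [Equiv.comp_symm_eq, Pi.single_comp_equiv, σ.symm_apply_apply]
  rw [generalizedW_apply, generalizedW_apply, ← Equiv.sum_comp σ]
  simp only [hsingle, Function.comp_apply]

lemma generalizedW_label (lam : Fin 3 → ℝ) (c a b : Fin 2) :
    generalizedW lam (label σ c a b) =
      ![!![0, (lam (σ 2) : ℂ); (lam (σ 1) : ℂ), 0], !![(lam (σ 0) : ℂ), 0; 0, 0]] c a b := by
  rw [show label σ c a b = ![c, a, b] ∘ σ.symm from rfl, generalizedW_comp_symm]
  fin_cases c <;> fin_cases a <;> fin_cases b <;> simp [generalizedW, ket]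

lemma mul_amplitudeMatrix_generalizedW (p : Fin 2 × Fin 2) :
    (U * amplitudeMatrix (generalizedW lam) σ) i p =
      !![U i 1 * lam (σ 0), U i 0 * lam (σ 2); U i 0 * lam (σ 1), 0] p.1 p.2 := by
  obtain ⟨a, b⟩ := p
  fin_cases a <;> fin_cases b <;>
    simp [Matrix.mul_apply, amplitudeMatrix, generalizedW_label]

lemma outcomeProb_generalizedW :
    outcomeProb (pureState (generalizedW lam)) σ U i =
      ‖U i 0‖ ^ 2 * (lam (σ 1) ^ 2 + lam (σ 2) ^ 2) + ‖U i 1‖ ^ 2 * lam (σ 0) ^ 2 := by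
  simp only [outcomeProb_pureState, mul_amplitudeMatrix_generalizedW, Fintype.sum_prod_type,
    Fin.sum_univ_two, Matrix.of_apply, Matrix.cons_val_zero, Matrix.cons_val_one, norm_mul,
    Complex.norm_real, mul_pow, Real.norm_eq_abs, sq_abs, norm_zero]
  ring

lemma concurrence_mul_amplitudeMatrix_generalizedW :
    concurrence ((U * amplitudeMatrix (generalizedW lam) σ) i) =
      ‖U i 0‖ ^ 2 * (2 * |lam (σ 1) * lam (σ 2)|) := by
  simp only [concurrence, mul_amplitudeMatrix_generalizedW, Matrix.of_apply, Matrix.cons_val_zero,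
    Matrix.cons_val_one, mul_zero, zero_sub, norm_neg, norm_mul, Complex.norm_real,
    Real.norm_eq_abs, abs_mul]
  ring

lemma controllerState_generalizedW :
    controllerState (pureState (generalizedW lam)) σ = Matrix.diagonal fun c =>
      ((![lam (σ 1) ^ 2 + lam (σ 2) ^ 2, lam (σ 0) ^ 2] c : ℝ) : ℂ) := by
  ext c c'
  rw [controllerState_pureState, Matrix.mul_apply, Fintype.sum_prod_type]
  fin_cases c <;> fin_cases c' <;> simp [amplitudeMatrix, generalizedW_label, sq, add_comm]

lemma sum_sq_comp_perm (lam : Fin 3 → ℝ) :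
    lam (σ 0) ^ 2 + lam (σ 1) ^ 2 + lam (σ 2) ^ 2 = ∑ i, lam i ^ 2 := by
  rw [← Equiv.sum_comp σ, Fin.sum_univ_three]

section Normalized

variable (hnorm : ∑ i, lam i ^ 2 = 1)
include hnorm

lemma vonNeumannEntropy_controllerState_generalizedW :
    vonNeumannEntropy (controllerState (pureState (generalizedW lam)) σ) =
      binaryEntropy (lam (σ 0) ^ 2) := by
  have hsum := (sum_sq_comp_perm σ lam).trans hnorm
  rw [controllerState_generalizedW, vonNeumannEntropy_diagonal, Fin.sum_univ_two,
    binaryEntropy_eq_binEntropy_div, Real.binEntropy_eq_negMulLog_add_negMulLog_one_sub, add_comm]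
  congr
  change lam (σ 1) ^ 2 + lam (σ 2) ^ 2 = 1 - lam (σ 0) ^ 2
  linarith

lemma capacity_pairState_generalizedW :
    capacity (pairState (pureState (generalizedW lam)) σ) =
      1 + binaryEntropy (lam (σ 2) ^ 2) - binaryEntropy (lam (σ 0) ^ 2) := by
  rw [capacity_pairState_pureState, vonNeumannEntropy_controllerState_generalizedW _ hnorm,
    vonNeumannEntropy_controllerState_generalizedW _ hnorm, Equiv.Perm.mul_apply,
    Equiv.swap_apply_left]

lemma averageCapacity_generalizedW {U : Op1} (hU : U ∈ Matrix.unitaryGroup (Fin 2) ℂ) :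
    averageCapacity (pureState (generalizedW lam)) σ U =
      1 + ∑ i, outcomeProb (pureState (generalizedW lam)) σ U i *
        entropyOfConcurrence (‖U i 0‖ ^ 2 * (2 * |lam (σ 1) * lam (σ 2)|) /
          outcomeProb (pureState (generalizedW lam)) σ U i) := by
  have htrace : (controllerState (pureState (generalizedW lam)) σ).trace.re = 1 := by
    rw [controllerState_generalizedW, Matrix.trace_diagonal, Fin.sum_univ_two]
    norm_cast
    rw [← hnorm, ← sum_sq_comp_perm σ]
    exact (add_comm _ _).trans (add_assoc _ _ _).symm
  rw [averageCapacity_pureState, Finset.sum_add_distrib, sum_outcomeProb _ _ hU, htrace]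
  simp only [concurrence_mul_amplitudeMatrix_generalizedW]

lemma averageCapacity_generalizedW_le {U : Op1} (hU : U ∈ Matrix.unitaryGroup (Fin 2) ℂ) :
    averageCapacity (pureState (generalizedW lam)) σ U ≤
      1 + (lam (σ 1) ^ 2 + lam (σ 2) ^ 2) *
        binaryEntropy (lam (σ 1) ^ 2 / (lam (σ 1) ^ 2 + lam (σ 2) ^ 2)) := by
  rw [averageCapacity_generalizedW σ hnorm hU]
  refine add_le_add_right ?_ 1
  calc
    _ ≤ ∑ i, ‖U i 0‖ ^ 2 * ((lam (σ 1) ^ 2 + lam (σ 2) ^ 2) *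
          binaryEntropy (lam (σ 1) ^ 2 / (lam (σ 1) ^ 2 + lam (σ 2) ^ 2))) := by
      refine Finset.sum_le_sum fun i _ => mul_entropyOfConcurrence_mul_div_le (sq_nonneg _) ?_
      rw [outcomeProb_generalizedW]
      exact le_add_of_nonneg_right (by positivity)
    _ = _ := by rw [← Finset.sum_mul, sum_norm_sq_col_of_mem_unitaryGroup hU, one_mul]

lemma averageCapacity_generalizedW_one :
    averageCapacity (pureState (generalizedW lam)) σ 1 =
      1 + (lam (σ 1) ^ 2 + lam (σ 2) ^ 2) *
        binaryEntropy (lam (σ 1) ^ 2 / (lam (σ 1) ^ 2 + lam (σ 2) ^ 2)) := by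
  have hprob : outcomeProb (pureState (generalizedW lam)) σ 1 0 =
      lam (σ 1) ^ 2 + lam (σ 2) ^ 2 := by simp [outcomeProb_generalizedW]
  rw [averageCapacity_generalizedW σ hnorm (one_mem _), Fin.sum_univ_two, hprob,
    Matrix.one_apply_eq, Matrix.one_apply_ne one_ne_zero, norm_one, norm_zero, one_pow, one_mul,
    zero_pow two_ne_zero, zero_mul, zero_div, entropyOfConcurrence_zero, mul_zero, add_zero,
    entropyOfConcurrence_two_mul_abs_mul_div]

lemma averageCapacity_generalizedW_le_one {U : Op1} (hU : U ∈ Matrix.unitaryGroup (Fin 2) ℂ) :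
    averageCapacity (pureState (generalizedW lam)) σ U ≤
      averageCapacity (pureState (generalizedW lam)) σ 1 :=
  (averageCapacity_generalizedW_le σ hnorm hU).trans_eq
    (averageCapacity_generalizedW_one σ hnorm).symm

lemma controlledCapacity_generalizedW :
    controlledCapacity (pureState (generalizedW lam)) σ =
      averageCapacity (pureState (generalizedW lam)) σ 1 := by
  have hgreatest : IsGreatest (Set.range fun U : Matrix.unitaryGroup (Fin 2) ℂ =>
      averageCapacity (pureState (generalizedW lam)) σ U)
      (averageCapacity (pureState (generalizedW lam)) σ 1) :=
    ⟨⟨1, rfl⟩, Set.forall_mem_range.mpr fun U => averageCapacity_generalizedW_le_one σ hnorm U.2⟩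
  exact hgreatest.csSup_eq

lemma controlPower_generalizedW_eq_sub :
    controlPower (pureState (generalizedW lam)) σ =
      (∑ i, Real.negMulLog (lam i ^ 2)) / Real.log 2 - binaryEntropy (lam (σ 2) ^ 2) := by
  have hsum := (sum_sq_comp_perm σ lam).trans hnorm
  rw [controlPower, controlledCapacity_generalizedW σ hnorm,
    averageCapacity_generalizedW_one σ hnorm, capacity_pairState_generalizedW σ hnorm,
    add_mul_binaryEntropy_div_add (sq_nonneg _) (sq_nonneg _),
    binaryEntropy_eq_binEntropy_div (lam (σ 0) ^ 2),
    Real.binEntropy_eq_negMulLog_add_negMulLog_one_sub,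
    show 1 - lam (σ 0) ^ 2 = lam (σ 1) ^ 2 + lam (σ 2) ^ 2 by linarith,
    ← Equiv.sum_comp σ, Fin.sum_univ_three]
  ring

lemma controlPower_generalizedW :
    controlPower (pureState (generalizedW lam)) σ =
      (lam (σ 0) ^ 2 + lam (σ 1) ^ 2) *
        binaryEntropy (lam (σ 0) ^ 2 / (lam (σ 0) ^ 2 + lam (σ 1) ^ 2)) := by
  have hsum := (sum_sq_comp_perm σ lam).trans hnorm
  rw [controlPower_generalizedW_eq_sub σ hnorm,
    add_mul_binaryEntropy_div_add (sq_nonneg _) (sq_nonneg _),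
    binaryEntropy_eq_binEntropy_div, Real.binEntropy_eq_negMulLog_add_negMulLog_one_sub,
    show 1 - lam (σ 2) ^ 2 = lam (σ 0) ^ 2 + lam (σ 1) ^ 2 by linarith,
    ← Equiv.sum_comp σ, Fin.sum_univ_three]
  ring

lemma controlPower_generalizedW_nonneg : 0 ≤ controlPower (pureState (generalizedW lam)) σ := by
  rw [controlPower_generalizedW σ hnorm]
  exact add_mul_binaryEntropy_div_add_nonneg (sq_nonneg _) (sq_nonneg _)

lemma controlPower_generalizedW_eq_zero_iff :
    controlPower (pureState (generalizedW lam)) σ = 0 ↔ lam (σ 0) = 0 ∨ lam (σ 1) = 0 := by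
  rw [controlPower_generalizedW σ hnorm,
    add_mul_binaryEntropy_div_add_eq_zero_iff (sq_nonneg _) (sq_nonneg _), sq_eq_zero_iff,
    sq_eq_zero_iff]

variable {σ} in
lemma controlPower_generalizedW_le (hσ : ∀ i, |lam i| ≤ |lam (σ 2)|) (τ : Equiv.Perm (Fin 3)) :
    controlPower (pureState (generalizedW lam)) σ ≤
      controlPower (pureState (generalizedW lam)) τ := by
  rw [controlPower_generalizedW_eq_sub σ hnorm, controlPower_generalizedW_eq_sub τ hnorm]
  refine sub_le_sub_left ?_ _
  rcases eq_or_ne (τ 2) (σ 2) with heq | hne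
  · rw [heq]
  have hpair : lam (τ 2) ^ 2 + lam (σ 2) ^ 2 ≤ ∑ i, lam i ^ 2 :=
    Finset.add_le_sum (fun i _ => sq_nonneg (lam i)) (Finset.mem_univ _) (Finset.mem_univ _) hne
  exact binaryEntropy_le_binaryEntropy (sq_nonneg _) (sq_le_sq.mpr (hσ _)) (by linarith)

variable {σ} in
lemma minimalControlPower_generalizedW_eq (hσ : ∀ i, |lam i| ≤ |lam (σ 2)|) :
    minimalControlPower (pureState (generalizedW lam)) =
      controlPower (pureState (generalizedW lam)) σ :=
  le_antisymm (Finset.inf'_le _ (Finset.mem_univ _))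
    (Finset.le_inf' _ _ fun τ _ => controlPower_generalizedW_le hnorm hσ τ)

lemma minimalControlPower_generalizedW_eq_zero_iff :
    minimalControlPower (pureState (generalizedW lam)) = 0 ↔ ∃ i, lam i = 0 := by
  constructor
  · intro hzero
    obtain ⟨σ, -, hσ⟩ := Finset.exists_mem_eq_inf' Finset.univ_nonempty
      (controlPower (pureState (generalizedW lam)))
    rcases (controlPower_generalizedW_eq_zero_iff σ hnorm).mp (hσ.symm.trans hzero) with h | h
    exacts [⟨_, h⟩, ⟨_, h⟩]
  · rintro ⟨j, hj⟩
    have hpower : controlPower (pureState (generalizedW lam)) (Equiv.swap 0 j) = 0 :=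
      (controlPower_generalizedW_eq_zero_iff _ hnorm).mpr
        (Or.inl (by rwa [Equiv.swap_apply_left]))
    refine le_antisymm (hpower ▸ Finset.inf'_le _ (Finset.mem_univ _)) ?_
    exact Finset.le_inf' _ _ fun σ _ => controlPower_generalizedW_nonneg σ hnorm

end Normalized

lemma exists_eq_zero_iff_isBiseparableOrFullySeparable (lam : Fin 3 → ℝ) :
    (∃ i, lam i = 0) ↔ IsBiseparableOrFullySeparable (generalizedW lam) := by
  constructor
  · rintro ⟨j, hj⟩
    refine ⟨Equiv.swap 0 j, Pi.single 0 1,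
      fun a b => generalizedW lam (label (Equiv.swap 0 j) 0 a b), fun c a b => ?_⟩
    fin_cases c
    · simp
    · fin_cases a <;> fin_cases b <;> simp [generalizedW_label, hj]
  · rintro ⟨σ, φ, χ, hprod⟩
    have h100 : (lam (σ 0) : ℂ) = φ 1 * χ 0 0 := by rw [← hprod, generalizedW_label]; rfl
    have h010 : (lam (σ 1) : ℂ) = φ 0 * χ 1 0 := by rw [← hprod, generalizedW_label]; rfl
    have h110 : 0 = φ 1 * χ 1 0 := by rw [← hprod, generalizedW_label]; rfl
    have hzero : (lam (σ 0) : ℂ) * lam (σ 1) = 0 := by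
      linear_combination h100 * lam (σ 1) + φ 1 * χ 0 0 * h010 - φ 0 * χ 0 0 * h110
    rcases mul_eq_zero.mp hzero with h | h
    exacts [⟨σ 0, Complex.ofReal_eq_zero.mp h⟩, ⟨σ 1, Complex.ofReal_eq_zero.mp h⟩]

end GeneralizedW

end DenseCoding

open DenseCoding in
theorem mainTheorem6_general (lam : Fin 3 → ℝ) (hnorm : ∑ i, lam i ^ 2 = 1) :
    (∀ (σ : Equiv.Perm (Fin 3)) (U : Matrix.unitaryGroup (Fin 2) ℂ),
      averageCapacity (pureState (generalizedW lam)) σ U ≤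
        averageCapacity (pureState (generalizedW lam)) σ 1) ∧
    (∀ σ : Equiv.Perm (Fin 3),
      controlPower (pureState (generalizedW lam)) σ =
        (lam (σ 0) ^ 2 + lam (σ 1) ^ 2) *
          binaryEntropy (lam (σ 0) ^ 2 / (lam (σ 0) ^ 2 + lam (σ 1) ^ 2))) ∧
    (∀ σ : Equiv.Perm (Fin 3), (∀ i, |lam i| ≤ |lam (σ 2)|) →
      minimalControlPower (pureState (generalizedW lam)) =
          controlPower (pureState (generalizedW lam)) σ ∧
      minimalControlPower (pureState (generalizedW lam)) =
        (lam (σ 0) ^ 2 + lam (σ 1) ^ 2) *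
          binaryEntropy (lam (σ 0) ^ 2 / (lam (σ 0) ^ 2 + lam (σ 1) ^ 2))) ∧
    (minimalControlPower (pureState (generalizedW lam)) = 0 ↔
      ∃ i, lam i = 0) ∧
    ((∃ i, lam i = 0) ↔
      IsBiseparableOrFullySeparable (generalizedW lam)) := by
  refine ⟨fun σ U => averageCapacity_generalizedW_le_one σ hnorm U.2,
    fun σ => controlPower_generalizedW σ hnorm, fun σ hσ => ?_,
    minimalControlPower_generalizedW_eq_zero_iff hnorm,
    exists_eq_zero_iff_isBiseparableOrFullySeparable lam⟩
  have hmin := minimalControlPower_generalizedW_eq hnorm hσ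
  exact ⟨hmin, hmin.trans (controlPower_generalizedW σ hnorm)⟩

theorem mainTheorem6 (lam : Fin 3 → ℝ) (hnonneg : ∀ i, 0 ≤ lam i)
    (hnorm : ∑ i, lam i ^ 2 = 1) :
    -- the computational basis is an optimal measurement basis of the controller
    (∀ (σ : Equiv.Perm (Fin 3)) (U : Matrix.unitaryGroup (Fin 2) ℂ),
      DenseCoding.averageCapacity (DenseCoding.pureState (DenseCoding.generalizedW lam)) σ U ≤
        DenseCoding.averageCapacity (DenseCoding.pureState (DenseCoding.generalizedW lam)) σ 1) ∧
    -- the control powers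
    (∀ σ : Equiv.Perm (Fin 3),
      DenseCoding.controlPower (DenseCoding.pureState (DenseCoding.generalizedW lam)) σ =
        (lam (σ 0) ^ 2 + lam (σ 1) ^ 2) *
          DenseCoding.binaryEntropy (lam (σ 0) ^ 2 / (lam (σ 0) ^ 2 + lam (σ 1) ^ 2))) ∧
    -- the minimal control power is attained where the receiver has the largest coefficient
    (∀ σ : Equiv.Perm (Fin 3), (∀ i, lam i ≤ lam (σ 2)) →
      DenseCoding.minimalControlPower (DenseCoding.pureState (DenseCoding.generalizedW lam)) =
          DenseCoding.controlPower (DenseCoding.pureState (DenseCoding.generalizedW lam)) σ ∧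
      DenseCoding.minimalControlPower (DenseCoding.pureState (DenseCoding.generalizedW lam)) =
        (lam (σ 0) ^ 2 + lam (σ 1) ^ 2) *
          DenseCoding.binaryEntropy (lam (σ 0) ^ 2 / (lam (σ 0) ^ 2 + lam (σ 1) ^ 2))) ∧
    -- the minimal control power vanishes exactly if some coefficient does
    (DenseCoding.minimalControlPower (DenseCoding.pureState (DenseCoding.generalizedW lam)) = 0 ↔
      ∃ i, lam i = 0) ∧
    -- which means exactly that the state is biseparable or fully separable
    ((∃ i, lam i = 0) ↔
      DenseCoding.IsBiseparableOrFullySeparable (DenseCoding.generalizedW lam)) := by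
  simpa only [abs_of_nonneg (hnonneg _)] using mainTheorem6_general lam hnorm
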